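/- Let $S^1=\mathbb R/\mathbb Z$; diffeomorphisms of $S^1$ are of class $C^1$. Two diffeomorphisms are $\varepsilon$-$C^1$-close if they have lifts $F,G:\mathbb R\to\mathbb R$ with $|F-G|<\varepsilon$ and $|F'-G'|<\varepsilon$ everywhere. Definitions. Sequences $x_0,\dots,x_n$ and $y_0,\dots,y_n$ in $S^1$ are \emph{similarly ordered} if there is an orientation preserving homeomorphism $\varphi$ of $S^1$ with $\varphi(x_k)=y_k$ for $0\le k\le n$. For $n\ge 2$, the \emph{initial} (resp. \emph{final}) \emph{basic interval} of an orbit segment $\{x,f(x),\dots,f^n(x)\}$ is the positively oriented arc $[a,b]$ (resp. $[c,d]$) with endpoints in the segment such that $(a,b)\cap\{x,\dots,f^n(x)\}=\{x\}$ (resp. $(c,d)\cap\{x,\dots,f^n(x)\}=\{f^n(x)\}$). Write $c=f^i(x)$ and $d=f^j(x)$ with $0\le i,j\le n$; the segment is \emph{adapted} if $n\ge 2$, $i\ne0$, $j\ne0$ and $i+j\ne n-1$. Its \emph{initial} and \emph{final ratios} are $$R_0=\frac{\ell([a,x])}{\ell([x,b])},\qquad R_n=\frac{\ell([c,f^n(x)])}{\ell([f^n(x),d])},$$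 where $\ell$ is the length of arcs. Theorem. Let $f$ and $g$ be two orientation preserving $C^1$ diffeomorphisms of $S^1$ with the same irrational rotation number $\alpha\in(\mathbb R\setminus\mathbb Q)/\mathbb Z$, all of whose orbits are dense. Assume that for every $\varepsilon>0$ there are a $C^1$ diffeomorphism $\tilde g$ that is $\varepsilon$-$C^1$-close to $g$, an integer $n$, and points $x,y\in S^1$ such that the orbit segments $\{x,\dots,f^n(x)\}$ and $\{y,\dots,\tilde g^n(y)\}$ are adapted, similarly ordered, and have the same initial ratio and the same final ratio. Then there are $C^1$ diffeomorphisms $h_m$ ($m\in\mathbb N$) of $S^1$ such that $h_m f h_m^{-1}\to g$ in the $C^1$ topology as $m\to\infty$. -/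

import Mathlib

open Filter

namespace CircleDiffeo

/-- `F : ℝ → ℝ` is a `C¹` lift of `f : ℝ/ℤ → ℝ/ℤ` whose derivative vanishes nowhere. -/
def IsC1Lift (F : ℝ → ℝ) (f : UnitAddCircle ≃ₜ UnitAddCircle) : Prop :=
  ContDiff ℝ 1 F ∧ (∀ t : ℝ, deriv F t ≠ 0) ∧ ∀ t : ℝ, (F t : UnitAddCircle) = f (t : UnitAddCircle)

/-- A homeomorphism of the circle `ℝ/ℤ` is a `C¹` diffeomorphism: read in the universal cover it is
`C¹` with nowhere vanishing derivative (so that its inverse is `C¹` too). -/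
def IsC1Diffeo (f : UnitAddCircle ≃ₜ UnitAddCircle) : Prop :=
  ∃ F : ℝ → ℝ, IsC1Lift F f

/-- `f` and `g` are `ε`-close in the `C¹` topology: they have lifts which, together with their
derivatives, differ by less than `ε` everywhere (the differences are continuous and periodic when
`ε` is small, so this is the same as having suprema less than `ε`). The derivative of a lift does
not depend on the lift. -/
def C1Close (ε : ℝ) (f g : UnitAddCircle ≃ₜ UnitAddCircle) : Prop :=
  ∃ F G : ℝ → ℝ, IsC1Lift F f ∧ IsC1Lift G g ∧
    ∀ t : ℝ, |F t - G t| < ε ∧ |deriv F t - deriv G t| < ε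

/-- The sequence `u n` converges to `g` in the `C¹` topology. -/
def C1Tendsto (u : ℕ → UnitAddCircle ≃ₜ UnitAddCircle) (g : UnitAddCircle ≃ₜ UnitAddCircle) : Prop :=
  ∀ ε : ℝ, 0 < ε → ∀ᶠ n in atTop, C1Close ε (u n) g

/-- `F` is a continuous nondecreasing lift of `f` commuting with `t ↦ t + 1`. -/
def IsMonotoneLift (F : CircleDeg1Lift) (f : UnitAddCircle ≃ₜ UnitAddCircle) : Prop :=
  Continuous F ∧ ∀ t : ℝ, (F t : UnitAddCircle) = f (t : UnitAddCircle)

/-- Orientation preserving homeomorphisms of the circle. -/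
def IsOrientationPreserving (f : UnitAddCircle ≃ₜ UnitAddCircle) : Prop :=
  ∃ F : CircleDeg1Lift, IsMonotoneLift F f

/-- `f` preserves the orientation and its rotation number, the class modulo `ℤ` of the translation
number of a lift, is `ρ`. -/
def HasRotationNumber (f : UnitAddCircle ≃ₜ UnitAddCircle) (ρ : UnitAddCircle) : Prop :=
  ∃ F : CircleDeg1Lift, IsMonotoneLift F f ∧ (F.translationNumber : UnitAddCircle) = ρ

/-- All orbits of `f` are dense. -/
def HasDenseOrbits (f : UnitAddCircle ≃ₜ UnitAddCircle) : Prop :=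
  ∀ x : UnitAddCircle, Dense (Set.range fun k : ℤ => (f ^ k) x)

/-- The finite sequences `p 0, …, p n` and `q 0, …, q n` are similarly ordered on the circle. -/
def SimilarlyOrdered (n : ℕ) (p q : ℕ → UnitAddCircle) : Prop :=
  ∃ φ : UnitAddCircle ≃ₜ UnitAddCircle, IsOrientationPreserving φ ∧ ∀ k ≤ n, φ (p k) = q k

/-- The length in `[0, 1)` of the arc that runs from `a` to `b` in the positive direction. -/
noncomputable def arcLength (a b : UnitAddCircle) : ℝ :=
  (AddCircle.equivIco 1 0 (b - a) : ℝ)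

/-- The forward orbit of `x`. -/
def orb (f : UnitAddCircle ≃ₜ UnitAddCircle) (x : UnitAddCircle) (k : ℕ) : UnitAddCircle :=
  (f ^ k) x

/-- `[f^i x, f^j x]` is the basic interval at `f^k x` of the orbit segment `x, …, f^n x`: the open
positively oriented arc from `f^i x` to `f^j x` meets the segment exactly in `f^k x`. -/
def IsBasicInterval (f : UnitAddCircle ≃ₜ UnitAddCircle) (x : UnitAddCircle) (n k i j : ℕ) : Prop :=
  i ≤ n ∧ j ≤ n ∧
    {z : UnitAddCircle | sbtw (orb f x i) z (orb f x j)} ∩ orb f x '' Set.Iic n = {orb f x k}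

/-- The orbit segment `x, …, f^n x` is adapted: `n ≥ 2` and its final basic interval
`[f^i x, f^j x]` has `i ≠ 0`, `j ≠ 0` and `i + j ≠ n - 1`. -/
def IsAdapted (f : UnitAddCircle ≃ₜ UnitAddCircle) (x : UnitAddCircle) (n : ℕ) : Prop :=
  2 ≤ n ∧ ∃ i j : ℕ, IsBasicInterval f x n n i j ∧ i ≠ 0 ∧ j ≠ 0 ∧ i + j ≠ n - 1

/-- `R` is the ratio `ℓ([a, z]) / ℓ([z, b])`, where `z = f^k x` and `[a, b]` is the basic interval at
`z` of the orbit segment `x, …, f^n x`. The initial ratio is the case `k = 0`, the final ratio the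
case `k = n`. -/
def HasRatio (f : UnitAddCircle ≃ₜ UnitAddCircle) (x : UnitAddCircle) (n k : ℕ) (R : ℝ) : Prop :=
  ∃ i j : ℕ, IsBasicInterval f x n k i j ∧
    R = arcLength (orb f x i) (orb f x k) / arcLength (orb f x k) (orb f x j)

/-- The orbit segments `x, …, f^n x` and `y, …, g^n y` have the same initial ratio and the same final
ratio. -/
def SameRatios (f g : UnitAddCircle ≃ₜ UnitAddCircle) (x y : UnitAddCircle) (n : ℕ) : Prop :=
  (∃ R : ℝ, HasRatio f x n 0 R ∧ HasRatio g y n 0 R) ∧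
    ∃ R : ℝ, HasRatio f x n n R ∧ HasRatio g y n n R

end CircleDiffeo

open CircleDiffeo

/-! Rotation by `α` serves as an intermediary: `f` has conjugates `C¹`-close to it, and it has
conjugates `C¹`-close to `g`. Everything is computed with the cocycle `logD`, which conjugation
changes by a coboundary.

For the first half, a topological conjugacy to the rotation (`exists_conjugacy`) turns `logD F^[n]`
into a Birkhoff sum over the rotation. Such sums oscillate by `o(n)` and this one vanishes
somewhere, so `logD F^[n] / n` is uniformly small. Averaging `logD F^[i]` over `i < n` gives a
conjugacy after which the derivative is close to `1` (`exists_logD_conj_le`). As the translation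
number is still `α`, the conjugate is close to the rotation (`exists_close_translation`).

For the second half, first conjugate `g` in the same way until its derivative is close to `1`. The
topological conjugacy `U` from the rotation to the result is then averaged over a short window. By
the mean value theorem, the derivative of the average changes little along the rotation, so the
smoothed map conjugates the rotation to a diffeomorphism close to that result (`exists_smoothing`).
`exists_conj_close` composes the two halves. -/

namespace CircleDiffeo

/-- `V : ℝ → ℝ` is the lift of an orientation preserving `C¹` diffeomorphism of the circle. -/
structure IsDiffeoLift (V : ℝ → ℝ) : Prop where
  contDiff : ContDiff ℝ 1 V
  deriv_pos : ∀ x, 0 < deriv V x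
  map_add_one : ∀ x, V (x + 1) = V x + 1

/-- The logarithm of the derivative. -/
noncomputable def logD (V : ℝ → ℝ) (x : ℝ) : ℝ := Real.log (deriv V x)

/-! ### Compactness for periodic functions, and the calculus of lifts -/

theorem uniformContinuous_of_periodic {p : ℝ → ℝ} (hp : Function.Periodic p 1)
    (hc : Continuous p) : UniformContinuous p := by
  have h1 : Continuous (hp.lift : UnitAddCircle → ℝ) := continuous_quot_lift _ hc
  have h2 := CompactSpace.uniformContinuous_of_continuous h1
  have h3 : UniformContinuous ((↑) : ℝ → UnitAddCircle) := by
    refine uniformContinuous_of_continuousAt_zero (QuotientAddGroup.mk' _) ?_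
    exact (AddCircle.continuous_mk' (1 : ℝ)).continuousAt
  exact h2.comp h3

theorem uniformContinuous_of_map_add_one {V : ℝ → ℝ} (hV : ∀ x, V (x + 1) = V x + 1)
    (hc : Continuous V) : UniformContinuous V := by
  have h := uniformContinuous_of_periodic (p := fun x => V x - x)
    (fun x => by simp only [hV]; ring) (hc.sub continuous_id)
  simpa using h.add uniformContinuous_id

theorem exists_abs_le_of_periodic {p : ℝ → ℝ} (hp : Function.Periodic p 1) (hc : Continuous p) :
    ∃ B, 0 < B ∧ ∀ x, |p x| ≤ B := by
  obtain ⟨B, hB⟩ := (hp.isBounded_of_continuous one_ne_zero hc).exists_norm_le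
  exact ⟨max B 1, by positivity, fun x => (hB _ ⟨x, rfl⟩).trans (le_max_left _ _)⟩

theorem map_add_int_of_map_add_one {V : ℝ → ℝ} (hV : ∀ x, V (x + 1) = V x + 1) (x : ℝ) (m : ℤ) :
    V (x + m) = V x + m := by
  have hp : Function.Periodic (fun x => V x - x) 1 := fun x => by simp only [hV]; ring
  have := hp.int_mul m x
  simp only [mul_one] at this
  linarith

namespace IsDiffeoLift

variable {V W : ℝ → ℝ}

theorem differentiable (hV : IsDiffeoLift V) : Differentiable ℝ V :=
  hV.contDiff.differentiable one_ne_zero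

theorem continuous (hV : IsDiffeoLift V) : Continuous V := hV.contDiff.continuous

theorem hasDerivAt (hV : IsDiffeoLift V) (x : ℝ) : HasDerivAt V (deriv V x) x :=
  (hV.differentiable x).hasDerivAt

theorem continuous_deriv (hV : IsDiffeoLift V) : Continuous (deriv V) :=
  hV.contDiff.continuous_deriv le_rfl

theorem strictMono (hV : IsDiffeoLift V) : StrictMono V := strictMono_of_deriv_pos hV.deriv_pos

theorem periodic_deriv (hV : IsDiffeoLift V) : Function.Periodic (deriv V) 1 := fun x => by
  have h1 : deriv (fun x => V (x + 1)) x = deriv V (x + 1) := deriv_comp_add_const _ _ _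
  rw [← h1, funext hV.map_add_one, deriv_add_const]

theorem exp_logD (hV : IsDiffeoLift V) (x : ℝ) : Real.exp (logD V x) = deriv V x :=
  Real.exp_log (hV.deriv_pos x)

theorem continuous_logD (hV : IsDiffeoLift V) : Continuous (logD V) :=
  hV.continuous_deriv.log fun x => (hV.deriv_pos x).ne'

theorem periodic_logD (hV : IsDiffeoLift V) : Function.Periodic (logD V) 1 := fun x => by
  rw [logD, hV.periodic_deriv x, logD]

theorem comp (hV : IsDiffeoLift V) (hW : IsDiffeoLift W) : IsDiffeoLift (V ∘ W) where
  contDiff := hV.contDiff.comp hW.contDiff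
  deriv_pos x := by
    rw [deriv_comp x (hV.differentiable _) (hW.differentiable _)]
    exact mul_pos (hV.deriv_pos _) (hW.deriv_pos _)
  map_add_one x := by simp [hV.map_add_one, hW.map_add_one]

theorem logD_comp (hV : IsDiffeoLift V) (hW : IsDiffeoLift W) (x : ℝ) :
    logD (V ∘ W) x = logD V (W x) + logD W x := by
  rw [logD, deriv_comp x (hV.differentiable _) (hW.differentiable _),
    Real.log_mul (hV.deriv_pos _).ne' (hW.deriv_pos _).ne', logD, logD]

theorem id : IsDiffeoLift id where
  contDiff := contDiff_id
  deriv_pos x := by simp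
  map_add_one x := rfl

theorem iterate (hV : IsDiffeoLift V) : ∀ n : ℕ, IsDiffeoLift V^[n]
  | 0 => IsDiffeoLift.id
  | n + 1 => by rw [Function.iterate_succ]; exact (hV.iterate n).comp hV

/-- The lift as an element of `CircleDeg1Lift`. -/
def toCircleDeg1Lift (hV : IsDiffeoLift V) : CircleDeg1Lift where
  toFun := V
  monotone' := hV.strictMono.monotone
  map_add_one' := hV.map_add_one

@[simp] theorem coe_toCircleDeg1Lift (hV : IsDiffeoLift V) : ⇑hV.toCircleDeg1Lift = V := rfl

theorem surjective (hV : IsDiffeoLift V) : Function.Surjective V :=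
  hV.toCircleDeg1Lift.continuous_iff_surjective.1 hV.continuous

theorem exists_inverse (hV : IsDiffeoLift V) :
    ∃ W, IsDiffeoLift W ∧ Function.LeftInverse W V ∧ Function.RightInverse W V := by
  let e : ℝ ≃ₜ ℝ := (hV.strictMono.orderIsoOfSurjective V hV.surjective).toHomeomorph
  have he : ∀ x, e x = V x := fun x => rfl
  have hl : Function.LeftInverse e.symm V := fun x => e.symm_apply_apply x
  have hr : Function.RightInverse e.symm V := fun x => e.apply_symm_apply x
  have hcd : ContDiff ℝ 1 (e.symm : ℝ → ℝ) :=
    e.contDiff_symm_deriv (fun x => (hV.deriv_pos x).ne') hV.hasDerivAt hV.contDiff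
  refine ⟨e.symm, ⟨hcd, fun x => ?_, fun x => ?_⟩, hl, hr⟩
  · have h1 : deriv (V ∘ e.symm) x = deriv V (e.symm x) * deriv e.symm x :=
      deriv_comp x (hV.differentiable _) (hcd.differentiable one_ne_zero _)
    rw [hr.comp_eq_id, deriv_id] at h1
    exact pos_of_mul_pos_right (h1 ▸ one_pos) (hV.deriv_pos _).le
  · rw [← hV.strictMono.injective.eq_iff, hr, hV.map_add_one, hr]

end IsDiffeoLift

/-! ### Passing between the circle and its universal cover -/

/-- The homeomorphism of the circle with a given lift. -/
theorem exists_homeomorph_of_lift {V W : ℝ → ℝ} (hV : IsDiffeoLift V) (hW : IsDiffeoLift W)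
    (hl : Function.LeftInverse W V) (hr : Function.RightInverse W V) :
    ∃ v : UnitAddCircle ≃ₜ UnitAddCircle, (∀ x : ℝ, v x = (V x : UnitAddCircle)) ∧
      ∀ x : ℝ, v⁻¹ x = (W x : UnitAddCircle) := by
  have key : ∀ {V : ℝ → ℝ}, IsDiffeoLift V →
      Function.Periodic (fun x => (V x : UnitAddCircle)) 1 := fun hV x => by
    simp only [hV.map_add_one, AddCircle.coe_add, AddCircle.coe_period, add_zero]
  refine ⟨⟨⟨(key hV).lift, (key hW).lift, fun x => ?_, fun x => ?_⟩, ?_, ?_⟩, ?_, ?_⟩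
  · induction x using QuotientAddGroup.induction_on with | H z => ?_
    exact congrArg _ (hl z)
  · induction x using QuotientAddGroup.induction_on with | H z => ?_
    exact congrArg _ (hr z)
  · exact continuous_quot_lift _ ((AddCircle.continuous_mk' 1).comp hV.continuous)
  · exact continuous_quot_lift _ ((AddCircle.continuous_mk' 1).comp hW.continuous)
  · exact fun x => rfl
  · exact fun x => rfl

/-- The smooth lift and the monotone lift differ by a continuous integer-valued function, hence by a
constant; a further integer shift makes the translation number equal to `α` itself. -/
theorem exists_lift_of_hasRotationNumber {α : ℝ} {f : UnitAddCircle ≃ₜ UnitAddCircle}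
    (hf : IsC1Diffeo f) (hfα : HasRotationNumber f (α : UnitAddCircle)) :
    ∃ (F : ℝ → ℝ) (hF : IsDiffeoLift F), (∀ x : ℝ, (F x : UnitAddCircle) = f x) ∧
      hF.toCircleDeg1Lift.translationNumber = α := by
  obtain ⟨F₀, hF₀, hd₀, hl₀⟩ := hf
  obtain ⟨F, ⟨hFc, hFl⟩, hFα⟩ := hfα
  obtain ⟨m, hm⟩ : ∃ m : ℤ, m + F.translationNumber = α := by
    obtain ⟨m, hm⟩ := AddSubgroup.mem_zmultiples_iff.1 (QuotientAddGroup.eq.1 hFα)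
    exact ⟨m, by simp at hm; linarith⟩
  have hint : ∀ x, ∃ n : ℤ, F₀ x - F x = n := fun x => by
    obtain ⟨n, hn⟩ := AddSubgroup.mem_zmultiples_iff.1
      (QuotientAddGroup.eq.1 ((hFl x).trans (hl₀ x).symm))
    exact ⟨n, by simp at hn; linarith⟩
  choose n hn using hint
  have hnc : Continuous n := by
    rw [Int.isClosedEmbedding_coe_real.isInducing.continuous_iff]
    exact (hF₀.continuous.sub hFc).congr hn
  have hn0 : ∀ x, F₀ x = F x + n 0 := fun x => by
    have h1 := hn x
    rw [PreconnectedSpace.constant inferInstance hnc (x := x) (y := 0)] at h1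
    linarith
  -- `IsC1Lift` only asks for a nonzero derivative; monotonicity decides its sign.
  have hmono : Monotone F₀ := fun x y hxy => by
    rw [hn0, hn0]
    exact add_le_add_left (F.monotone hxy) _
  have hF : IsDiffeoLift fun x => F₀ x + (m - n 0) :=
    ⟨hF₀.add contDiff_const, fun x => by
      rw [deriv_add_const]
      exact lt_of_le_of_ne hmono.deriv_nonneg (hd₀ x).symm, fun x => by
      simp only [hn0, F.map_add_one]; ring⟩
  refine ⟨_, hF, fun x => ?_, ?_⟩
  · rw [← hl₀]
    refine QuotientAddGroup.eq.2 (AddSubgroup.mem_zmultiples_iff.2 ⟨n 0 - m, ?_⟩)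
    simp
  · have h1 : hF.toCircleDeg1Lift =
        (CircleDeg1Lift.translate (Multiplicative.ofAdd (m : ℝ)) : CircleDeg1Lift) * F := by
      ext x
      simp only [IsDiffeoLift.coe_toCircleDeg1Lift, CircleDeg1Lift.mul_apply,
        CircleDeg1Lift.translate_apply, hn0]
      ring
    rw [h1, CircleDeg1Lift.translationNumber_mul_of_commute,
      CircleDeg1Lift.translationNumber_translate, hm]
    rw [commute_iff_eq]
    ext x
    simp [CircleDeg1Lift.mul_apply, CircleDeg1Lift.translate_apply]

/-! ### Topological conjugacy to the rotation -/

theorem exists_int_mul_add_int_mem {α : ℝ} (hα : Irrational α) {a b : ℝ} (hab : a < b) :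
    ∃ k m : ℤ, k * α + m ∈ Set.Ioo a b := by
  have hd : Dense (AddSubgroup.closure {α, 1} : Set ℝ) :=
    dense_addSubgroupClosure_pair_iff.2 (by simpa using hα)
  obtain ⟨y, hy, hyab⟩ := hd.exists_mem_open isOpen_Ioo (Set.nonempty_Ioo.2 hab)
  obtain ⟨k, m, h⟩ := AddSubgroup.mem_closure_pair.1 hy
  exact ⟨k, m, by simpa [← h] using hyab⟩

theorem apply_add_nat_mul_of_semiconj {α : ℝ} {U G : ℝ → ℝ} (hU : ∀ x, U (x + α) = G (U x)) (n : ℕ)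
    (x : ℝ) : U (x + n * α) = G^[n] (U x) := by
  induction n with
  | zero => simp
  | succ n ih =>
    rw [Function.iterate_succ_apply', ← ih, ← hU]
    push_cast
    ring_nf

/-- Equal translation numbers give a monotone semiconjugacy. Dense orbits make its range dense,
hence it is continuous; irrationality makes it injective. -/
theorem exists_conjugacy {α : ℝ} (hα : Irrational α) {g : UnitAddCircle ≃ₜ UnitAddCircle}
    (hgd : HasDenseOrbits g) {G : ℝ → ℝ} (hG : IsDiffeoLift G)
    (hGg : ∀ x : ℝ, (G x : UnitAddCircle) = g x)
    (hτ : hG.toCircleDeg1Lift.translationNumber = α) :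
    ∃ U : ℝ → ℝ, Continuous U ∧ StrictMono U ∧ (∀ x, U (x + 1) = U x + 1) ∧
      ∀ x, U (x + α) = G (U x) := by
  obtain ⟨U, hU⟩ := CircleDeg1Lift.semiconj_of_bijective_of_translationNumber_eq
    (f₁ := CircleDeg1Lift.translate (Multiplicative.ofAdd α)) (f₂ := hG.toCircleDeg1Lift)
    (CircleDeg1Lift.isUnit_iff_bijective.1 (Units.isUnit _))
    ⟨hG.strictMono.injective, hG.surjective⟩
    (by rw [CircleDeg1Lift.translationNumber_translate, hτ])
  have hUα : ∀ x, U (x + α) = G (U x) := fun x => by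
    simpa [add_comm] using hU x
  have hgU : ∀ x : ℝ, g (U x : UnitAddCircle) = (U (x + α) : UnitAddCircle) := fun x => by
    rw [← hGg, hUα]
  have hgUk : ∀ (k : ℤ) (x : ℝ), (g ^ k) (U x : UnitAddCircle) = (U (x + k * α) : UnitAddCircle) := by
    intro k
    induction k using Int.induction_on with
    | zero => intro x; simp
    | succ n ih =>
      intro x
      rw [zpow_add_one, Homeomorph.mul_apply, hgU, ih]
      push_cast
      ring_nf
    | pred n ih =>
      intro x
      have h1 : g⁻¹ (U x : UnitAddCircle) = (U (x - α) : UnitAddCircle) := by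
        have h2 := hgU (x - α)
        rw [sub_add_cancel] at h2
        rw [← h2]
        exact g.symm_apply_apply _
      rw [zpow_sub_one, Homeomorph.mul_apply, h1, ih]
      push_cast
      ring_nf
  -- The range contains every integer translate of the lifted orbit of `U 0`.
  have hdense : DenseRange U := by
    refine dense_iff_inter_open.2 fun O hO hne => ?_
    obtain ⟨_, ⟨y, hy, hyk⟩, k, rfl⟩ := (hgd (U 0 : UnitAddCircle)).inter_open_nonempty _
      (QuotientAddGroup.isOpenMap_coe O hO) (hne.image _)
    simp only [hgUk] at hyk
    obtain ⟨m, hm⟩ := AddSubgroup.mem_zmultiples_iff.1 (QuotientAddGroup.eq.1 hyk.symm)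
    refine ⟨y, hy, 0 + k * α + m, ?_⟩
    rw [CircleDeg1Lift.map_add_int]
    simp at hm ⊢
    linarith
  -- A coincidence with `n > 0` would be a periodic orbit, making `α` rational.
  have hinj : ∀ (n : ℕ) (m : ℤ) x, ((n : ℤ) ≠ 0 ∨ m ≠ 0) → U (x + n * α + m) ≠ U x := by
    intro n m x hnm h
    rw [CircleDeg1Lift.map_add_int, apply_add_nat_mul_of_semiconj hUα] at h
    rcases Nat.eq_zero_or_pos n with rfl | hn
    · simp_all
    · have h1 := CircleDeg1Lift.translationNumber_of_map_pow_eq_add_int hG.toCircleDeg1Lift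
        (x := U x) (n := n) (m := -m) (by
          rw [CircleDeg1Lift.coe_pow, IsDiffeoLift.coe_toCircleDeg1Lift]; push_cast; linarith) hn
      rw [hτ] at h1
      exact hα ⟨(-m : ℤ) / (n : ℕ), by rw [h1]; push_cast; rfl⟩
  refine ⟨U, U.monotone.continuous_of_denseRange hdense,
    U.strictMono_iff_injective.2 fun a b hab => ?_, U.map_add_one, hUα⟩
  by_contra hne
  wlog hlt : a < b generalizing a b
  · exact this b a hab.symm (Ne.symm hne) (lt_of_le_of_ne (not_lt.1 hlt) (Ne.symm hne))
  -- A plateau `[a, b]` of `U` would contain both `a` and `a + k * α + m`.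
  obtain ⟨k, m, h0, h1⟩ := exists_int_mul_add_int_mem hα (sub_pos.2 hlt)
  have heq : U (a + k * α + m) = U a :=
    le_antisymm (hab ▸ U.monotone (by linarith)) (U.monotone (by linarith))
  have hkm : k ≠ 0 ∨ m ≠ 0 := by
    by_contra! h
    simp [h.1, h.2] at h0
  obtain ⟨l, rfl | rfl⟩ := k.eq_nat_or_neg
  · exact hinj l m a hkm (by simpa using heq)
  · refine hinj l (-m) (a + ((-l : ℤ) : ℝ) * α + m) (by simpa using hkm) ?_
    rw [heq]
    push_cast
    ring_nf

/-! ### Birkhoff sums and the growth of derivatives -/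

/-- Steps of size `p = k * α + m` in `(0, δ)` cross a unit interval in about `1 / p` moves, each
costing `|k|` rotations. If `k` is negative, the forward rotations carry `y` to `x` instead, whence
the disjunction. -/
theorem exists_bounded_return {α : ℝ} (hα : Irrational α) {δ : ℝ} (hδ : 0 < δ) :
    ∃ K : ℕ, ∀ x y : ℝ, ∃ l ≤ K, ∃ m : ℤ,
      |x + l * α + m - y| < δ ∨ |y + l * α + m - x| < δ := by
  obtain ⟨k, m, h0, h1⟩ := exists_int_mul_add_int_mem hα hδ
  set p := k * α + m with hp
  refine ⟨⌈1 / p⌉₊ * k.natAbs, fun x y => ?_⟩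
  set d := Int.fract (y - x) with hd
  set j := ⌊d / p⌋₊ with hj
  have hd0 : 0 ≤ d / p := div_nonneg (Int.fract_nonneg _) h0.le
  have hjK : j ≤ ⌈1 / p⌉₊ := by
    refine (Nat.floor_le_floor (a := d / p) (b := 1 / p) ?_).trans (Nat.floor_le_ceil _)
    gcongr
    exact (Int.fract_lt_one _).le
  have hj1 : j * p ≤ d := (le_div_iff₀ h0).1 (Nat.floor_le hd0)
  have hj2 : d < j * p + p := by
    have := (div_lt_iff₀ h0).1 (Nat.lt_floor_add_one (d / p))
    linarith
  have hdxy : d = y - x - ⌊y - x⌋ := rfl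
  refine ⟨j * k.natAbs, Nat.mul_le_mul_right _ hjK, ?_⟩
  obtain ⟨l, rfl | rfl⟩ := k.eq_nat_or_neg
  · refine ⟨j * m + ⌊y - x⌋, Or.inl (abs_lt.2 ?_)⟩
    simp only [Int.natAbs_natCast]
    push_cast at hp ⊢
    constructor <;> nlinarith
  · refine ⟨- (j * m + ⌊y - x⌋), Or.inr (abs_lt.2 ?_)⟩
    simp only [Int.natAbs_neg, Int.natAbs_natCast]
    push_cast at hp ⊢
    constructor <;> nlinarith

/-- Birkhoff sums over an irrational rotation have small oscillation. -/
theorem exists_birkhoff_oscillation_le {α : ℝ} (hα : Irrational α) {P : ℝ → ℝ}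
    (hP : Function.Periodic P 1) (hc : Continuous P) {ε : ℝ} (hε : 0 < ε) :
    ∃ n : ℕ, 0 < n ∧ ∀ x y, ∑ i ∈ Finset.range n, P (x + i * α) ≤
      ∑ i ∈ Finset.range n, P (y + i * α) + ε * n := by
  obtain ⟨δ, hδ, hPδ⟩ := Metric.uniformContinuous_iff.1 (uniformContinuous_of_periodic hP hc)
    (ε / 2) (half_pos hε)
  obtain ⟨B, hB, hPB⟩ := exists_abs_le_of_periodic hP hc
  obtain ⟨K, hK⟩ := exists_bounded_return hα hδ
  -- Moving the base point by at most `K` rotations costs at most `2 * K * B`, which is to be half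
  -- of the allowed `ε * n`.
  set n : ℕ := ⌈2 * K * B / (ε / 2)⌉₊ + 1 with hn
  have hnK : 2 * K * B ≤ ε / 2 * n := by
    have := Nat.le_ceil (2 * K * B / (ε / 2))
    rw [div_le_iff₀ (half_pos hε)] at this
    push_cast [hn]
    nlinarith
  set T : ℝ → ℝ := fun x => ∑ i ∈ Finset.range n, P (x + i * α) with hT
  -- One rotation only exchanges an end term of the sum for another.
  have hstep : ∀ x, |T (x + α) - T x| ≤ 2 * B := fun x => by
    have h1 : T (x + α) - T x = P (x + n * α) - P x := by
      have h2 := Finset.sum_range_succ' (fun i : ℕ => P (x + i * α)) n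
      rw [Finset.sum_range_succ] at h2
      have h3 : T (x + α) = ∑ i ∈ Finset.range n, P (x + ((i + 1 : ℕ) : ℝ) * α) :=
        Finset.sum_congr rfl fun i _ => by push_cast; ring_nf
      rw [h3]
      simp only [Nat.cast_zero, zero_mul, add_zero] at h2
      simp only [hT]
      linarith
    rw [h1]
    have h4 := abs_le.1 (hPB x)
    have h5 := abs_le.1 (hPB (x + n * α))
    exact abs_le.2 ⟨by linarith, by linarith⟩
  have hsteps : ∀ (l : ℕ) x, |T (x + l * α) - T x| ≤ 2 * l * B := by
    intro l
    induction l with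
    | zero => simp
    | succ l ih =>
      intro x
      have h1 : x + ((l + 1 : ℕ) : ℝ) * α = (x + l * α) + α := by push_cast; ring
      have h2 := (abs_sub_le (T (x + l * α + α)) (T (x + l * α)) (T x)).trans
        (add_le_add (hstep _) (ih x))
      rw [h1]
      push_cast
      linarith
  have hclose : ∀ x y, |x - y| < δ → |T x - T y| ≤ ε / 2 * n := fun x y hxy => by
    rw [hT, ← Finset.sum_sub_distrib]
    refine (Finset.abs_sum_le_sum_abs _ _).trans ?_
    refine (Finset.sum_le_card_nsmul _ _ (ε / 2) fun i _ => ?_).trans_eq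
      (by rw [Finset.card_range, nsmul_eq_mul, mul_comm])
    refine (hPδ (a := x + i * α) (b := y + i * α) ?_).le
    rwa [Real.dist_eq, add_sub_add_right_eq_sub]
  have hint : ∀ x (m : ℤ), T (x + m) = T x := fun x m => Finset.sum_congr rfl fun i _ => by
    have := hP.int_mul m (x + i * α)
    rw [mul_one] at this
    rw [← this]
    ring_nf
  have hmain : ∀ x y (l : ℕ) (m : ℤ), l ≤ K → |x + l * α + m - y| < δ → |T x - T y| ≤ ε * n := by
    intro x y l m hl h
    have h1 := hclose _ _ h
    rw [hint] at h1
    have h2 := abs_sub_le (T x) (T (x + l * α)) (T y)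
    rw [abs_sub_comm (T x) (T (x + l * α))] at h2
    have h3 : 2 * (l : ℝ) * B ≤ 2 * K * B := by gcongr
    linarith [hsteps l x]
  refine ⟨n, Nat.succ_pos _, fun x y => ?_⟩
  obtain ⟨l, hl, m, h | h⟩ := hK x y
  · linarith [(abs_le.1 (hmain x y l m hl h)).2]
  · linarith [(abs_le.1 (hmain y x l m hl h)).1]

theorem IsDiffeoLift.logD_iterate {F : ℝ → ℝ} (hF : IsDiffeoLift F) (n : ℕ) (x : ℝ) :
    logD F^[n] x = ∑ i ∈ Finset.range n, logD F (F^[i] x) := by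
  induction n with
  | zero => simp [logD]
  | succ n ih =>
    rw [Function.iterate_succ', hF.logD_comp (hF.iterate n), ih, Finset.sum_range_succ, add_comm]

theorem IsDiffeoLift.exists_logD_eq_zero {F : ℝ → ℝ} (hF : IsDiffeoLift F) :
    ∃ x, logD F x = 0 := by
  obtain ⟨x, -, hx⟩ := exists_deriv_eq_slope F zero_lt_one hF.continuous.continuousOn
    hF.differentiable.differentiableOn
  refine ⟨x, ?_⟩
  have := hF.map_add_one 0
  rw [zero_add] at this
  rw [logD, hx, this]
  simp

/-- Small oscillation becomes smallness because `F^[n]` has derivative `1` somewhere. -/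
theorem exists_logD_iterate_le {α : ℝ} (hα : Irrational α) {F U : ℝ → ℝ} (hF : IsDiffeoLift F)
    (hUc : Continuous U) (hU1 : ∀ x, U (x + 1) = U x + 1) (hU : ∀ x, U (x + α) = F (U x))
    {ε : ℝ} (hε : 0 < ε) :
    ∃ n : ℕ, 0 < n ∧ ∀ x, |logD F^[n] x| ≤ ε * n := by
  obtain ⟨n, hn, h⟩ := exists_birkhoff_oscillation_le hα (P := fun z => logD F (U z))
    (fun x => by simp only [hU1, hF.periodic_logD (U x)]) (hF.continuous_logD.comp hUc) hε
  have hsurj : Function.Surjective U := by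
    have htop : Tendsto U atTop atTop ∧ Tendsto U atBot atBot := by
      obtain ⟨B, -, hB⟩ := exists_abs_le_of_periodic (p := fun x => U x - x)
        (fun x => by simp only [hU1]; ring) (hUc.sub continuous_id)
      exact ⟨tendsto_atTop_mono (fun x => by
          simp only [id_eq]; linarith [(abs_le.1 (hB x)).1])
        (tendsto_atTop_add_const_right _ (-B) tendsto_id),
        tendsto_atBot_mono (fun x => by
          simp only [id_eq]; linarith [(abs_le.1 (hB x)).2])
        (tendsto_atBot_add_const_right _ B tendsto_id)⟩
    exact hUc.surjective htop.1 htop.2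
  simp only [apply_add_nat_mul_of_semiconj hU, ← hF.logD_iterate] at h
  obtain ⟨x₀, hx₀⟩ := (hF.iterate n).exists_logD_eq_zero
  obtain ⟨z₀, rfl⟩ := hsurj x₀
  refine ⟨n, hn, fun x => ?_⟩
  obtain ⟨z, rfl⟩ := hsurj x
  have h1 := h z z₀
  have h2 := h z₀ z
  exact abs_le.2 ⟨by linarith, by linarith⟩

/-! ### Construction of the conjugating diffeomorphisms -/

/-- The primitive is divided by its integral over a period; the resulting constant `c` cancels in
coboundaries. -/
theorem exists_lift_of_density {ρ : ℝ → ℝ} (hρ : Function.Periodic ρ 1) (hc : Continuous ρ)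
    (hpos : ∀ x, 0 < ρ x) :
    ∃ V, IsDiffeoLift V ∧ ∃ c, ∀ x, logD V x = Real.log (ρ x) + c := by
  set I := ∫ t in (0 : ℝ)..1, ρ t with hI
  have hI0 : 0 < I := intervalIntegral.intervalIntegral_pos_of_pos (hc.intervalIntegrable _ _) hpos
    zero_lt_one
  have hd : ∀ x, HasDerivAt (fun x => (∫ t in (0 : ℝ)..x, ρ t) / I) (ρ x / I) x := fun x =>
    (hc.integral_hasStrictDerivAt 0 x).hasDerivAt.div_const I
  have hderiv : deriv (fun x => (∫ t in (0 : ℝ)..x, ρ t) / I) = fun x => ρ x / I :=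
    funext fun x => (hd x).deriv
  refine ⟨fun x => (∫ t in (0 : ℝ)..x, ρ t) / I, ⟨?_, fun x => ?_, fun x => ?_⟩, - Real.log I,
    fun x => ?_⟩
  · rw [contDiff_one_iff_deriv, hderiv]
    exact ⟨fun x => (hd x).differentiableAt, hc.div_const I⟩
  · rw [hderiv]
    exact div_pos (hpos x) hI0
  · have h1 := intervalIntegral.integral_add_adjacent_intervals (hc.intervalIntegrable 0 x)
      (hc.intervalIntegrable (μ := MeasureTheory.volume) x (x + 1))
    have h2 := hρ.intervalIntegral_add_eq x 0
    rw [zero_add] at h2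
    simp only [← h1, h2, add_div, ← hI, div_self hI0.ne']
  · rw [logD, hderiv, Real.log_div (hpos x).ne' hI0.ne', sub_eq_add_neg]

/-- Conjugating by a primitive of the geometric mean of the derivatives of the first iterates makes
the derivative of a diffeomorphism close to `1`. -/
theorem exists_logD_conj_le {F : ℝ → ℝ} (hF : IsDiffeoLift F) {n : ℕ} (hn : 0 < n) {ε : ℝ}
    (h : ∀ x, |logD F^[n] x| ≤ ε * n) :
    ∃ V, IsDiffeoLift V ∧ ∀ x, |logD V (F x) + logD F x - logD V x| ≤ ε := by
  have hn' : (0 : ℝ) < n := Nat.cast_pos.2 hn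
  obtain ⟨V, hV, c, hVc⟩ := exists_lift_of_density
    (ρ := fun x => Real.exp ((∑ i ∈ Finset.range n, logD F^[i] x) / n))
    (fun x => by simp only [(hF.iterate _).periodic_logD x])
    (Real.continuous_exp.comp ((continuous_finsetSum _ fun i _ =>
      (hF.iterate i).continuous_logD).div_const _)) fun x => Real.exp_pos _
  refine ⟨V, hV, fun x => ?_⟩
  -- By the chain rule each summand becomes `logD F^[i + 1] x`, so the sum telescopes.
  have h1 : ∑ i ∈ Finset.range n, logD F^[i] (F x) + n * logD F x
      = ∑ i ∈ Finset.range n, logD F^[i] x + logD F^[n] x := by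
    have h2 : ∀ i, logD F^[i] (F x) + logD F x = logD F^[i + 1] x := fun i => by
      rw [Function.iterate_succ, (hF.iterate i).logD_comp hF]
    have h3 := Finset.sum_range_succ' (fun i => logD F^[i] x) n
    rw [Finset.sum_range_succ, ← Finset.sum_congr rfl fun i _ => h2 i, Finset.sum_add_distrib,
      Finset.sum_const, Finset.card_range, nsmul_eq_mul] at h3
    have h4 : logD F^[0] x = 0 := by simp [logD]
    linarith
  have h5 : logD V (F x) + logD F x - logD V x = logD F^[n] x / n := by
    rw [hVc, hVc, Real.log_exp, Real.log_exp]
    field_simp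
    linarith
  rw [h5, abs_div, abs_of_pos hn', div_le_iff₀ hn']
  exact h x

/-- Smoothing a conjugacy from a rotation to a diffeomorphism whose derivative is close to `1`. -/
theorem exists_smoothing {α ε δ : ℝ} {U G : ℝ → ℝ} (hUc : Continuous U) (hUm : StrictMono U)
    (hU1 : ∀ x, U (x + 1) = U x + 1) (hU : ∀ x, U (x + α) = G (U x)) (hG : IsDiffeoLift G)
    (hGε : ∀ x, |logD G x| ≤ ε) (hδ : 0 < δ) :
    ∃ u, IsDiffeoLift u ∧ (∀ x, |u x - U x| < δ) ∧ ∀ x, |logD u (x + α) - logD u x| ≤ ε := by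
  obtain ⟨η, hη, hUη⟩ := Metric.uniformContinuous_iff.1 (uniformContinuous_of_map_add_one hU1 hUc)
    δ hδ
  have hd : ∀ x, HasDerivAt (fun x => ∫ t in (0 : ℝ)..x, U t) (U x) x := fun x =>
    (hUc.integral_hasStrictDerivAt 0 x).hasDerivAt
  have hd' : ∀ x, HasDerivAt (fun x => ((∫ t in (0 : ℝ)..(x + η), U t) -
      ∫ t in (0 : ℝ)..x, U t) / η) ((U (x + η) - U x) / η) x := fun x =>
    (((hd (x + η)).comp_add_const x η).sub (hd x)).div_const η
  set u : ℝ → ℝ := fun x => ((∫ t in (0 : ℝ)..(x + η), U t) - ∫ t in (0 : ℝ)..x, U t) / η with hu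
  have hderiv : deriv u = fun x => (U (x + η) - U x) / η := funext fun x => (hd' x).deriv
  have hpos : ∀ x, 0 < U (x + η) - U x := fun x => sub_pos.2 (hUm (by linarith))
  refine ⟨u, ⟨?_, fun x => ?_, fun x => ?_⟩, fun x => ?_, fun x => ?_⟩
  · rw [contDiff_one_iff_deriv, hderiv]
    exact ⟨fun x => (hd' x).differentiableAt,
      ((hUc.comp (continuous_id.add continuous_const)).sub hUc).div_const η⟩
  · rw [hderiv]
    exact div_pos (hpos x) hη
  · have hint : ∀ a b, IntervalIntegrable U MeasureTheory.volume a b := hUc.intervalIntegrable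
    have h1 : ∀ x, u x = (∫ t in x..(x + η), U t) / η := fun x => by
      simp only [hu]
      rw [← intervalIntegral.integral_add_adjacent_intervals (hint 0 x) (hint x (x + η)),
        add_sub_cancel_left]
    have h2 : ∫ t in (x + 1)..(x + 1 + η), U t = (∫ t in x..(x + η), U t) + η := by
      have h3 := intervalIntegral.integral_comp_add_right (a := x) (b := x + η) U 1
      rw [add_right_comm, ← h3]
      simp only [hU1]
      rw [intervalIntegral.integral_add (hint _ _) (by simp)]
      simp
    rw [h1, h1, h2, add_div, div_self hη.ne']
  -- The average over the window is a value of `U` inside it.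
  · obtain ⟨ξ, hξ, h⟩ := exists_hasDerivAt_eq_slope (fun x => ∫ t in (0 : ℝ)..x, U t) U
      (show x < x + η by linarith) (fun y _ => (hd y).continuousAt.continuousWithinAt)
      fun y _ => hd y
    rw [add_sub_cancel_left] at h
    have h1 : u x = U ξ := h.symm
    rw [h1]
    refine hUη ?_
    rw [Real.dist_eq, abs_lt]
    constructor <;> linarith [hξ.1, hξ.2]
  -- `G` maps the increment of `U` over the window at `x` to the one at `x + α`; their ratio is a
  -- value of `deriv G`.
  · obtain ⟨ξ, -, h⟩ := exists_deriv_eq_slope G (sub_pos.1 (hpos x)) hG.continuous.continuousOn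
      hG.differentiable.differentiableOn
    have h1 : logD u (x + α) - logD u x = logD G ξ := by
      have h2 := hpos (x + α)
      rw [logD, logD, hderiv, ← Real.log_div (div_pos h2 hη).ne' (div_pos (hpos x) hη).ne', logD, h,
        div_div_div_cancel_right₀ hη.ne', hU, add_right_comm, hU]
    rw [h1]
    exact hGε ξ

/-! ### Closeness estimates through `logD` -/

theorem exists_abs_exp_sub_one_lt {δ : ℝ} (hδ : 0 < δ) :
    ∃ κ, 0 < κ ∧ ∀ t : ℝ, |t| ≤ κ → |Real.exp t - 1| < δ := by
  obtain ⟨κ, hκ, h⟩ := Metric.continuousAt_iff.1 (Real.continuous_exp.continuousAt (x := 0)) δ hδ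
  refine ⟨κ / 2, half_pos hκ, fun t ht => ?_⟩
  have := h (x := t) (by rw [Real.dist_eq, sub_zero]; linarith)
  rwa [Real.dist_eq, Real.exp_zero] at this

namespace IsDiffeoLift

variable {F G V W : ℝ → ℝ}

theorem logD_of_leftInverse (hV : IsDiffeoLift V) (hW : IsDiffeoLift W)
    (hl : Function.LeftInverse W V) (x : ℝ) : logD W (V x) = -logD V x := by
  have h := hW.logD_comp hV x
  rw [hl.comp_eq_id] at h
  have h1 : logD _root_.id x = 0 := by simp [logD]
  linarith

/-- Evaluation at `V x` eliminates the inverse and leaves a coboundary. -/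
theorem logD_conj (hF : IsDiffeoLift F) (hV : IsDiffeoLift V) (hW : IsDiffeoLift W)
    (hl : Function.LeftInverse W V) (x : ℝ) :
    logD (V ∘ F ∘ W) (V x) = logD V (F x) + logD F x - logD V x := by
  rw [hV.logD_comp (hF.comp hW), hF.logD_comp hW, Function.comp_apply, hl,
    logD_of_leftInverse hV hW hl]
  ring

/-- Closeness of derivatives can be tested on their logarithms. -/
theorem exists_logD_close (hG : IsDiffeoLift G) {ε : ℝ} (hε : 0 < ε) :
    ∃ κ, 0 < κ ∧ ∀ V, IsDiffeoLift V → ∀ x, |logD V x - logD G x| ≤ κ →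
      |deriv V x - deriv G x| < ε := by
  obtain ⟨M, hM, hGM⟩ := exists_abs_le_of_periodic hG.periodic_deriv hG.continuous_deriv
  obtain ⟨κ, hκ, h⟩ := exists_abs_exp_sub_one_lt (div_pos hε hM)
  refine ⟨κ, hκ, fun V hV x hx => ?_⟩
  have h1 : deriv V x - deriv G x = deriv G x * (Real.exp (logD V x - logD G x) - 1) := by
    have := (hG.deriv_pos x).ne'
    rw [Real.exp_sub, hV.exp_logD, hG.exp_logD]
    field_simp
  rw [h1, abs_mul]
  calc _ ≤ M * |Real.exp (logD V x - logD G x) - 1| := by gcongr; exact hGM x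
    _ < M * (ε / M) := by gcongr; exact h _ hx
    _ = ε := by field_simp

/-- A diffeomorphism whose derivative is close to `1` is close to a rotation. -/
theorem exists_close_translation {δ : ℝ} (hδ : 0 < δ) :
    ∃ κ, 0 < κ ∧ ∀ (F : ℝ → ℝ) (hF : IsDiffeoLift F), (∀ x, |logD F x| ≤ κ) →
      ∀ x, |F x - (x + hF.toCircleDeg1Lift.translationNumber)| < δ := by
  obtain ⟨κ, hκ, h⟩ := exists_abs_exp_sub_one_lt (half_pos hδ)
  refine ⟨κ, hκ, fun F hF hFκ x => ?_⟩
  obtain ⟨x₀, hx₀⟩ := hF.toCircleDeg1Lift.exists_eq_add_translationNumber hF.continuous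
  rw [coe_toCircleDeg1Lift] at hx₀
  have hd : ∀ y, HasDerivAt (fun y => F y - y) (deriv F y - 1) y := fun y =>
    (hF.hasDerivAt y).sub (hasDerivAt_id y)
  -- `F - id` is periodic and equals the translation number at `x₀`, so it is enough to compare
  -- points at distance at most `1`.
  set y := x - ⌊x - x₀⌋ with hy
  have h1 := Convex.norm_image_sub_le_of_norm_deriv_le (f := fun y => F y - y) (C := δ / 2)
    (fun z _ => (hd z).differentiableAt) (fun z _ => by
      rw [(hd z).deriv, Real.norm_eq_abs, ← hF.exp_logD]
      exact (h _ (hFκ z)).le) convex_univ (Set.mem_univ x₀) (Set.mem_univ y)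
  have h2 : F y = F x - ⌊x - x₀⌋ := by
    have := map_add_int_of_map_add_one hF.map_add_one x (-⌊x - x₀⌋)
    push_cast at this
    rw [hy, sub_eq_add_neg x, this]
    ring
  have h3 : ‖y - x₀‖ ≤ 1 := by
    have h4 : y - x₀ = Int.fract (x - x₀) := by rw [hy, Int.fract]; ring
    rw [h4, Real.norm_eq_abs, abs_of_nonneg (Int.fract_nonneg _)]
    exact (Int.fract_lt_one _).le
  have h5 : F x - (x + hF.toCircleDeg1Lift.translationNumber) = F y - y - (F x₀ - x₀) := by
    rw [h2, hx₀, hy]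
    ring
  rw [h5, ← Real.norm_eq_abs]
  have h6 := h1.trans (mul_le_mul_of_nonneg_left h3 (half_pos hδ).le)
  linarith

end IsDiffeoLift

/-! ### Composing the two conjugations -/

theorem exists_conj_logD_le {α : ℝ} (hα : Irrational α) {f : UnitAddCircle ≃ₜ UnitAddCircle}
    (hfd : HasDenseOrbits f) {F : ℝ → ℝ} (hF : IsDiffeoLift F)
    (hFf : ∀ x : ℝ, (F x : UnitAddCircle) = f x)
    (hτ : hF.toCircleDeg1Lift.translationNumber = α) {ε : ℝ} (hε : 0 < ε) :
    ∃ V, IsDiffeoLift V ∧ ∀ x, |logD V (F x) + logD F x - logD V x| ≤ ε := by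
  obtain ⟨U, hUc, -, hU1, hU⟩ := exists_conjugacy hα hfd hF hFf hτ
  obtain ⟨n, hn, h⟩ := exists_logD_iterate_le hα hF hUc hU1 hU hε
  exact exists_logD_conj_le hF hn h

/-- The conjugacy is `h⁻¹ ∘ u ∘ k`: `k` brings `F` near the rotation, `u` the rotation near `h ∘ G ∘
h⁻¹`. The order of choice is `h`, `u`, `k`, each tolerance depending on the moduli of continuity of
the earlier maps. -/
theorem exists_conj_close {α : ℝ} (hα : Irrational α) {f g : UnitAddCircle ≃ₜ UnitAddCircle}
    (hfd : HasDenseOrbits f) (hgd : HasDenseOrbits g) {F G : ℝ → ℝ} (hF : IsDiffeoLift F)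
    (hG : IsDiffeoLift G) (hFf : ∀ x : ℝ, (F x : UnitAddCircle) = f x)
    (hGg : ∀ x : ℝ, (G x : UnitAddCircle) = g x)
    (hFα : hF.toCircleDeg1Lift.translationNumber = α)
    (hGα : hG.toCircleDeg1Lift.translationNumber = α) {ε : ℝ} (hε : 0 < ε) :
    ∃ V W, IsDiffeoLift V ∧ IsDiffeoLift W ∧ Function.LeftInverse W V ∧
      Function.RightInverse W V ∧
      ∀ x, |(V ∘ F ∘ W) x - G x| < ε ∧ |deriv (V ∘ F ∘ W) x - deriv G x| < ε := by
  obtain ⟨κ, hκ, hclose⟩ := hG.exists_logD_close hε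
  -- Five errors are added at the end: continuity of `logD h` and of `logD u`, and the defects of
  -- `u`, `k` and `h`.
  set e := κ / 5 with he
  have he0 : 0 < e := by positivity
  obtain ⟨U, hUc, hUm, hU1, hU⟩ := exists_conjugacy hα hgd hG hGg hGα
  obtain ⟨h, hh, hhG⟩ := exists_conj_logD_le hα hgd hG hGg hGα he0
  obtain ⟨h', hh', hhl, hhr⟩ := hh.exists_inverse
  have hG₁ := hh.comp (hG.comp hh')
  have hG₁e : ∀ x, |logD (h ∘ G ∘ h') x| ≤ e := fun x => by
    rw [← hhr x, hG.logD_conj hh hh' hhl]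
    exact hhG _
  obtain ⟨η, hη, hhη⟩ := Metric.uniformContinuous_iff.1
    (uniformContinuous_of_periodic hh.periodic_logD hh.continuous_logD) e he0
  obtain ⟨δ, hδ, hh'δ⟩ := Metric.uniformContinuous_iff.1
    (uniformContinuous_of_map_add_one hh'.map_add_one hh'.continuous) (min ε η) (lt_min hε hη)
  obtain ⟨δ₁, hδ₁, hG₁δ⟩ := Metric.uniformContinuous_iff.1
    (uniformContinuous_of_map_add_one hG₁.map_add_one hG₁.continuous) (δ / 3) (by positivity)
  obtain ⟨u, hu, huU, hue⟩ := exists_smoothing (α := α) (hh.continuous.comp hUc)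
    (hh.strictMono.comp hUm) (fun x => by simp [hU1, hh.map_add_one])
    (fun x => by simp [hU, hhl (U x)]) hG₁ hG₁e (lt_min (show 0 < δ / 3 by positivity) hδ₁)
  obtain ⟨u', hu', hul, hur⟩ := hu.exists_inverse
  obtain ⟨η₁, hη₁, huη₁⟩ := Metric.uniformContinuous_iff.1
    (uniformContinuous_of_map_add_one hu.map_add_one hu.continuous) (δ / 3) (by positivity)
  obtain ⟨η₂, hη₂, huη₂⟩ := Metric.uniformContinuous_iff.1
    (uniformContinuous_of_periodic hu.periodic_logD hu.continuous_logD) e he0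
  obtain ⟨κ₁, hκ₁, htrans⟩ := IsDiffeoLift.exists_close_translation (lt_min hη₁ hη₂)
  obtain ⟨k, hk, hkF⟩ := exists_conj_logD_le hα hfd hF hFf hFα (lt_min he0 hκ₁)
  obtain ⟨k', hk', hkl, hkr⟩ := hk.exists_inverse
  have hF₁ := hk.comp (hF.comp hk')
  have hF₁α : hF₁.toCircleDeg1Lift.translationNumber = α := by
    rw [← hFα]
    refine (CircleDeg1Lift.translationNumber_eq_of_semiconj (f := hk.toCircleDeg1Lift)
      fun x => ?_).symm
    simp [hkl x]
  have hrot : ∀ x, |k (F x) - (k x + α)| < min η₁ η₂ := fun x => by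
    have h1 := htrans _ hF₁ (fun x => by
      rw [← hkr x, hF.logD_conj hk hk' hkl]
      exact (hkF _).trans (min_le_right _ _)) (k x)
    rwa [hF₁α, Function.comp_apply, Function.comp_apply, hkl] at h1
  have hV : IsDiffeoLift (h' ∘ u ∘ k) := hh'.comp (hu.comp hk)
  have hW : IsDiffeoLift (k' ∘ u' ∘ h) := hk'.comp (hu'.comp hh)
  have hl : Function.LeftInverse (k' ∘ u' ∘ h) (h' ∘ u ∘ k) := fun x => by
    simp only [Function.comp_apply, hhr (u (k x)), hul (k x), hkl x]
  have hr : Function.RightInverse (k' ∘ u' ∘ h) (h' ∘ u ∘ k) := fun x => by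
    simp only [Function.comp_apply, hkr (u' (h x)), hur (h x), hhl x]
  have hlogV : ∀ y, logD (h' ∘ u ∘ k) y =
      -logD h (h' (u (k y))) + logD u (k y) + logD k y := fun y => by
    have h1 := hh.logD_of_leftInverse hh' hhl (h' (u (k y)))
    rw [hhr] at h1
    rw [hh'.logD_comp (hu.comp hk), hu.logD_comp hk, Function.comp_apply, h1, add_assoc]
  refine ⟨_, _, hV, hW, hl, hr, fun x => ?_⟩
  obtain ⟨w, rfl⟩ := hV.surjective x
  set x := (h' ∘ u ∘ k) w with hx
  have hhx : h x = u (k w) := hhr _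
  have hθ : ((h' ∘ u ∘ k) ∘ F ∘ k' ∘ u' ∘ h) x = h' (u (k (F w))) := by
    simp only [Function.comp_apply, hhx, hul (k w), hkl w]
  have hC0 : |h' (u (k (F w))) - G x| < min ε η := by
    have h1 : |u (k (F w)) - u (k w + α)| < δ / 3 := huη₁ ((hrot w).trans_le (min_le_left _ _))
    have h2 : |u (k w + α) - h (U (k w + α))| < δ / 3 :=
      (huU _).trans_le (min_le_left _ _)
    have h3 : |h (U (k w + α)) - h (G x)| < δ / 3 := by
      -- `h ∘ G ∘ h'` sends `h (U (k w))` to `h (U (k w + α))` and `h x` to `h (G x)`.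
      have h4 := hG₁δ (a := h (U (k w))) (b := h x) (by
        rw [dist_comm, hhx]
        exact (huU _).trans_le (min_le_right _ _))
      simpa only [Function.comp_apply, hhl (U (k w)), hhl x, hU, Real.dist_eq] using h4
    have h5 := hh'δ (a := u (k (F w))) (b := h (G x)) (by
      have h6 := abs_sub_le (u (k (F w))) (u (k w + α)) (h (U (k w + α)))
      have h7 := abs_sub_le (u (k (F w))) (h (U (k w + α))) (h (G x))
      rw [Real.dist_eq]
      linarith)
    rwa [hhl] at h5
  refine ⟨hθ ▸ hC0.trans_le (min_le_left _ _), hclose _ (hV.comp (hF.comp hW)) x ?_⟩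
  have h1 : |logD h (h' (u (k (F w)))) - logD h (G x)| < e :=
    hhη (hC0.trans_le (min_le_right _ _))
  have h2 : |logD u (k (F w)) - logD u (k w + α)| < e :=
    huη₂ ((hrot w).trans_le (min_le_right _ _))
  have h3 := hue (k w)
  have h4 := (hkF w).trans (min_le_left _ _)
  have h5 := hhG x
  have h6 : logD ((h' ∘ u ∘ k) ∘ F ∘ k' ∘ u' ∘ h) x = -logD h (h' (u (k (F w)))) +
      logD u (k (F w)) + logD k (F w) + logD F w - (-logD h x + logD u (k w) + logD k w) := by
    rw [hx, hF.logD_conj hV hW hl, hlogV, hlogV]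
    rfl
  rw [h6]
  rw [abs_lt] at h1 h2
  rw [abs_le] at h3 h4 h5 ⊢
  constructor <;> linarith

end CircleDiffeo

/- The hypothesis `H` is not needed: `f` has conjugates arbitrarily close to the rotation by `α`, and
the rotation has conjugates arbitrarily close to `g`. -/
theorem mainTheorem3 (α : ℝ) (hα : Irrational α) (f g : UnitAddCircle ≃ₜ UnitAddCircle)
    (hf : IsC1Diffeo f) (hg : IsC1Diffeo g)
    (hfα : HasRotationNumber f (α : UnitAddCircle)) (hgα : HasRotationNumber g (α : UnitAddCircle))
    (hfd : HasDenseOrbits f) (hgd : HasDenseOrbits g)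
    (H : ∀ ε : ℝ, 0 < ε → ∃ g' : UnitAddCircle ≃ₜ UnitAddCircle, IsC1Diffeo g' ∧ C1Close ε g' g ∧
      ∃ (n : ℕ) (x y : UnitAddCircle), IsAdapted f x n ∧ IsAdapted g' y n ∧
        SimilarlyOrdered n (orb f x) (orb g' y) ∧ SameRatios f g' x y n) :
    ∃ h : ℕ → UnitAddCircle ≃ₜ UnitAddCircle, (∀ n : ℕ, IsC1Diffeo (h n)) ∧
      C1Tendsto (fun n : ℕ => h n * f * (h n)⁻¹) g := by
  obtain ⟨F, hF, hFf, hFα⟩ := exists_lift_of_hasRotationNumber hf hfα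
  obtain ⟨G, hG, hGg, hGα⟩ := exists_lift_of_hasRotationNumber hg hgα
  have key : ∀ ε : ℝ, 0 < ε → ∃ h : UnitAddCircle ≃ₜ UnitAddCircle, IsC1Diffeo h ∧
      C1Close ε (h * f * h⁻¹) g := fun ε hε => by
    obtain ⟨V, W, hV, hW, hl, hr, hVW⟩ :=
      exists_conj_close hα hfd hgd hF hG hFf hGg hFα hGα hε
    obtain ⟨v, hvV, hvW⟩ := exists_homeomorph_of_lift hV hW hl hr
    have hθ := hV.comp (hF.comp hW)
    refine ⟨v, ⟨V, hV.contDiff, fun t => (hV.deriv_pos t).ne', fun t => (hvV t).symm⟩,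
      V ∘ F ∘ W, G, ⟨hθ.contDiff, fun t => (hθ.deriv_pos t).ne', fun t => ?_⟩,
      ⟨hG.contDiff, fun t => (hG.deriv_pos t).ne', hGg⟩, hVW⟩
    rw [Homeomorph.mul_apply, Homeomorph.mul_apply, hvW, ← hFf, hvV]
    rfl
  choose h hh hhg using fun n : ℕ => key (1 / (n + 1)) Nat.one_div_pos_of_nat
  refine ⟨h, hh, fun ε hε => ?_⟩
  filter_upwards [tendsto_one_div_add_atTop_nhds_zero_nat.eventually_lt_const hε] with n hn
  obtain ⟨A, B, hA, hB, hAB⟩ := hhg n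
  exact ⟨A, B, hA, hB, fun t => ⟨(hAB t).1.trans hn, (hAB t).2.trans hn⟩⟩
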